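/- Let $d\ge 2$, and let $\mathcal{P}_d(d+2)$ denote the family of $d$-dimensional convex polytopes in $\mathbb{R}^d$ that have exactly $d+2$ vertices and are inscribed in the unit sphere $\mathbb{S}^{d-1}$ centred at the origin (that is, all their vertices lie on $\mathbb{S}^{d-1}$). Let $P \in \mathcal{P}_d(d+2)$ have maximal volume over $\mathcal{P}_d(d+2)$. Then $P=\operatorname{conv}(P_1\cup P_2)$, where $P_1$ and $P_2$ are regular simplices of dimensions $\lfloor d/2\rfloor$ and $\lceil d/2\rceil$, respectively, inscribed in $\mathbb{S}^{d-1}$ and contained in orthogonal linear subspaces of $\mathbb{R}^d$. Furthermore, the maximum $v_d(d+2)=\max\{\operatorname{vol}_d(P) : P\in\mathcal{P}_d(d+2)\}$ exists and $$ v_d(d+2)=\frac{1}{d!}\cdot\frac{\left(\lfloor d/2\rfloor+1\right)^{\frac{\lfloor d/2\rfloor+1}{2}}\cdot\left(\lceil d/2\rceil+1\right)^{\frac{\lceil d/2\rceil+1}{2}}}{\lfloor d/2\rfloor^{\frac{\lfloor d/2\rfloor}{2}}\cdot\lceil d/2\rceil^{\frac{\lceil d/2\rceil}{2}}}. $$ 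-/

import Mathlib

/-- A (convex) polytope: the convex hull of finitely many points. -/
def IsConvexPolytope {d : ℕ} (P : Set (EuclideanSpace ℝ (Fin d))) : Prop :=
  ∃ S : Finset (EuclideanSpace ℝ (Fin d)), P = convexHull ℝ (S : Set (EuclideanSpace ℝ (Fin d)))

/-- `inscribedPolytopes d n` is the family of the `d`-dimensional polytopes in `ℝ^d` that have
exactly `n` vertices and are inscribed in the unit sphere centred at the origin (all their vertices
lie on the sphere). The vertices of a polytope are its extreme points; `P` is `d`-dimensional when
its affine hull is the whole space. -/
def inscribedPolytopes (d n : ℕ) : Set (Set (EuclideanSpace ℝ (Fin d))) :=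
  {P | IsConvexPolytope P ∧ affineSpan ℝ P = ⊤ ∧ (P.extremePoints ℝ).ncard = n ∧
    P.extremePoints ℝ ⊆ Metric.sphere 0 1}

/-- The volumes of the members of `inscribedPolytopes d n`. -/
def inscribedVolumes (d n : ℕ) : Set ℝ :=
  {v | ∃ P ∈ inscribedPolytopes d n, v = MeasureTheory.volume.real P}

/-- `v_d(n)`, the maximal volume of a member of `inscribedPolytopes d n`. It is a supremum here;
where it is used, it is stated separately that it is attained. -/
noncomputable def maxInscribedVolume (d n : ℕ) : ℝ :=
  sSup (inscribedVolumes d n)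

/-! Any `d + 2` points of `ℝ^d` have an affine dependence `c`. With `A` the set of its positive
indices, deleting one point of `A` at a time gives simplices that cover the convex hull, with
volumes proportional to `c i`. They add up to `|det M| / d!`, where the rows of `M = indicatorLift A
p` are `(1_A(i), 1, p i)` (`sum_volume_facets`).

For points on the sphere, scaling rows and columns of `M` makes its rows unit vectors, so Hadamard's
inequality bounds `det M ^ 2` by `simplexFactor k * simplexFactor m`, with `k + 1` and `m + 1` the
sizes of `A` and its complement. Equality means orthonormal rows, which is the Gram matrix of two
regular simplices in orthogonal subspaces (`det_indicatorLift_sq_le`). Strict convexity of the ball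
gives `k, m ≥ 1`, and strict concavity of `log simplexFactor` singles out the balanced split of `d`
(`simplexFactor_mul_le`).

The upper bound needs only the covering; attaining it also needs that the simplices overlap in null
sets (`volume_convexHull_eq`). -/

/-! ### Volume of a simplex as a determinant. -/

open scoped Pointwise in
theorem volume_corner_simplex (n : ℕ) :
    MeasureTheory.volume {x : Fin n → ℝ | (∀ i, 0 ≤ x i) ∧ ∑ i, x i ≤ 1} =
      ENNReal.ofReal (1 / n.factorial) := by
  induction n with
  | zero =>
    have : {x : Fin 0 → ℝ | (∀ i, 0 ≤ x i) ∧ ∑ i, x i ≤ 1} = Set.univ := by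
      ext x; simp
    rw [this, ← Set.pi_univ Set.univ, MeasureTheory.volume_pi_pi]
    simp
  | succ n ih =>
    set T : Set (Fin n → ℝ) := {x | (∀ i, 0 ≤ x i) ∧ ∑ i, x i ≤ 1} with hT
    set S : Set (ℝ × (Fin n → ℝ)) :=
      {z | 0 ≤ z.1 ∧ (∀ i, 0 ≤ z.2 i) ∧ z.1 + ∑ i, z.2 i ≤ 1} with hS
    have hSm : MeasurableSet S := by
      apply IsClosed.measurableSet
      simp only [hS, Set.ofPred_and, Set.ofPred_forall]
      refine (isClosed_le (by fun_prop) (by fun_prop)).inter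
        ((isClosed_iInter fun i => isClosed_le (by fun_prop) (by fun_prop)).inter
          (isClosed_le (by fun_prop) (by fun_prop)))
    have h1 : {x : Fin (n + 1) → ℝ | (∀ i, 0 ≤ x i) ∧ ∑ i, x i ≤ 1} =
        MeasurableEquiv.piFinSuccAbove (fun _ => ℝ) 0 ⁻¹' S := by
      ext x
      simp [hS, Fin.forall_fin_succ, Fin.sum_univ_succ, Fin.tail, and_assoc]
    rw [h1, (MeasureTheory.volume_preserving_piFinSuccAbove (fun _ => ℝ) 0).measure_preimage
      hSm.nullMeasurableSet, MeasureTheory.Measure.volume_eq_prod,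
      MeasureTheory.Measure.prod_apply hSm]
    -- The slice at height `t` is the `(1 - t)`-dilate of the `n`-dimensional corner simplex.
    have hslice : ∀ t : ℝ, MeasureTheory.volume (Prod.mk t ⁻¹' S) =
        (Set.Icc (0 : ℝ) 1).indicator
          (fun t => ENNReal.ofReal ((1 - t) ^ n * (1 / n.factorial))) t := by
      intro t
      by_cases ht : t ∈ Set.Icc (0 : ℝ) 1
      · rw [Set.indicator_of_mem ht]
        have : Prod.mk t ⁻¹' S = (1 - t) • T := by
          ext y
          rcases eq_or_lt_of_le ht.2 with rfl | hlt
          · have hne : T.Nonempty := ⟨0, by simp [hT]⟩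
            rw [sub_self, Set.zero_smul_set hne]
            simp only [hS, Set.mem_preimage, Set.mem_ofPred_eq, Set.mem_zero]
            constructor
            · rintro ⟨-, h0, h⟩
              have h' : ∑ i, y i = 0 := le_antisymm (by linarith)
                (Finset.sum_nonneg fun i _ => h0 i)
              ext i
              exact (Finset.sum_eq_zero_iff_of_nonneg fun i _ => h0 i).1 h' i (Finset.mem_univ _)
            · rintro rfl
              simp
          · have hp : 0 < 1 - t := by linarith
            rw [Set.mem_smul_set_iff_inv_smul_mem₀ hp.ne']
            simp only [hS, hT, Set.mem_preimage, Set.mem_ofPred_eq, Pi.smul_apply, smul_eq_mul,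
              ← Finset.mul_sum]
            rw [inv_mul_le_iff₀ hp]
            constructor
            · rintro ⟨-, h0, h⟩
              exact ⟨fun i => mul_nonneg (inv_nonneg.2 hp.le) (h0 i), by linarith⟩
            · rintro ⟨h0, h⟩
              refine ⟨ht.1, fun i => ?_, by linarith⟩
              have := h0 i
              rwa [mul_nonneg_iff_of_pos_left (inv_pos.2 hp)] at this
        rw [this, MeasureTheory.Measure.addHaar_smul, ih, Module.finrank_fintype_fun_eq_card,
          Fintype.card_fin, abs_of_nonneg (pow_nonneg (by linarith [ht.2]) _),
          ENNReal.ofReal_mul (pow_nonneg (by linarith [ht.2]) _)]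
      · rw [Set.indicator_of_notMem ht]
        convert MeasureTheory.measure_empty (μ := MeasureTheory.volume)
        ext y
        simp only [hS, Set.mem_preimage, Set.mem_ofPred_eq, Set.mem_empty_iff_false, iff_false]
        rintro ⟨h0, hy, h⟩
        exact ht ⟨h0, by linarith [Finset.sum_nonneg fun i (_ : i ∈ Finset.univ) => hy i]⟩
    simp_rw [hslice]
    rw [MeasureTheory.lintegral_indicator measurableSet_Icc,
      ← MeasureTheory.ofReal_integral_eq_lintegral_ofReal]
    · rw [MeasureTheory.integral_Icc_eq_integral_Ioc,
        ← intervalIntegral.integral_of_le zero_le_one, intervalIntegral.integral_mul_const,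
        intervalIntegral.integral_comp_sub_left (fun x : ℝ => x ^ n) 1]
      simp only [sub_self, sub_zero, integral_pow]
      congr 1
      rw [Nat.factorial_succ]
      have : (n.factorial : ℝ) ≠ 0 := by positivity
      push_cast
      field_simp
      simp
    · exact (Continuous.integrableOn_Icc (by fun_prop))
    · filter_upwards [MeasureTheory.ae_restrict_mem measurableSet_Icc] with t ht
      exact mul_nonneg (pow_nonneg (by linarith [ht.2]) _) (by positivity)

theorem mem_convexHull_range_iff {ι E : Type*} [Fintype ι] [AddCommGroup E] [Module ℝ E]
    {v : ι → E} {x : E} :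
    x ∈ convexHull ℝ (Set.range v) ↔
      ∃ w : ι → ℝ, (∀ i, 0 ≤ w i) ∧ ∑ i, w i = 1 ∧ ∑ i, w i • v i = x := by
  classical
  constructor
  · intro hx
    rw [convexHull_range_eq_exists_affineCombination] at hx
    obtain ⟨s, w, h0, h1, rfl⟩ := hx
    refine ⟨fun i => if i ∈ s then w i else 0, fun i => ?_, ?_, ?_⟩
    · dsimp only
      split_ifs with h
      exacts [h0 i h, le_rfl]
    · simpa using h1
    · rw [Finset.affineCombination_eq_linear_combination _ _ _ h1]
      simp [ite_smul]
  · rintro ⟨w, h0, h1, rfl⟩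
    exact mem_convexHull_of_exists_fintype w v h0 h1 (fun i => ⟨i, rfl⟩) rfl

/-- Subtracting row `0` from the others reduces the determinant to that of the edge vectors at `q
0`; the linear map with these columns, followed by a translation, carries the corner simplex onto
the hull. -/
theorem volume_convexHull_range_simplex {d : ℕ} (q : Fin (d + 1) → EuclideanSpace ℝ (Fin d)) :
    MeasureTheory.volume (convexHull ℝ (Set.range q)) =
      ENNReal.ofReal (|(Matrix.of fun i => (Fin.cons 1 (q i) : Fin (d + 1) → ℝ)).det| /
        d.factorial) := by
  set B : Matrix (Fin d) (Fin d) ℝ := Matrix.of fun i j => q j.succ i - q 0 i with hB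
  have hdet : (Matrix.of fun i => (Fin.cons 1 (q i) : Fin (d + 1) → ℝ)).det = B.det := by
    rw [Matrix.det_eq_of_forall_row_eq_smul_add_const
      (B := Matrix.of fun i => if i = 0 then (Fin.cons 1 (q 0) : Fin (d + 1) → ℝ)
        else Fin.cons 0 (q i - q 0)) (fun i => if i = 0 then 0 else 1) 0 (by simp)]
    · rw [Matrix.det_succ_column_zero, Fin.sum_univ_succ]
      simp only [Matrix.of_apply]
      rw [Finset.sum_eq_zero, ← Matrix.det_transpose B]
      · simp only [if_true, Fin.cons_zero, Fin.val_zero, pow_zero, one_mul, add_zero]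
        congr 1
      · intro i _
        simp
    · intro i j
      refine Fin.cases ?_ (fun i => ?_) i <;> refine Fin.cases ?_ (fun j => ?_) j <;> simp
  set f : EuclideanSpace ℝ (Fin d) →ₗ[ℝ] EuclideanSpace ℝ (Fin d) :=
    Matrix.toLin (EuclideanSpace.basisFun (Fin d) ℝ).toBasis
      (EuclideanSpace.basisFun (Fin d) ℝ).toBasis B with hf
  have hfx : ∀ x, f x = ∑ j, x j • (q j.succ - q 0) := by
    intro x
    ext i
    rw [hf, Matrix.toLin_apply]
    simp [Matrix.mulVec, dotProduct, hB, mul_comm, Pi.single_apply]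
  have himg : convexHull ℝ (Set.range q) = (fun x => q 0 + x) '' (f ''
      (WithLp.ofLp ⁻¹' {x : Fin d → ℝ | (∀ i, 0 ≤ x i) ∧ ∑ i, x i ≤ 1})) := by
    ext x
    rw [mem_convexHull_range_iff]
    simp only [Set.mem_image, exists_exists_and_eq_and, Set.mem_preimage, Set.mem_ofPred_eq, hfx]
    constructor
    · rintro ⟨w, h0, h1, rfl⟩
      rw [Fin.sum_univ_succ] at h1
      refine ⟨WithLp.toLp 2 fun j => w j.succ, ⟨fun i => h0 _, by simp; linarith [h0 0]⟩, ?_⟩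
      rw [Fin.sum_univ_succ, eq_sub_of_add_eq h1]
      simp only [smul_sub, Finset.sum_sub_distrib, ← Finset.sum_smul, sub_smul, one_smul]
      abel
    · rintro ⟨y, ⟨h0, h1⟩, rfl⟩
      refine ⟨Fin.cons (1 - ∑ i, y i) y, fun i => ?_, ?_, ?_⟩
      · refine Fin.cases ?_ (fun i => ?_) i
        · simpa using h1
        · simpa using h0 i
      · simp [Fin.sum_univ_succ]
      · simp only [Fin.sum_univ_succ, Fin.cons_zero, Fin.cons_succ]
        simp only [smul_sub, Finset.sum_sub_distrib, ← Finset.sum_smul, sub_smul, one_smul]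
        abel
  have hT : MeasurableSet {x : Fin d → ℝ | (∀ i, 0 ≤ x i) ∧ ∑ i, x i ≤ 1} := by
    apply IsClosed.measurableSet
    simp only [Set.ofPred_and, Set.ofPred_forall]
    exact (isClosed_iInter fun i => isClosed_le (by fun_prop) (by fun_prop)).inter
      (isClosed_le (by fun_prop) (by fun_prop))
  rw [himg, Set.image_add_left, MeasureTheory.measure_preimage_add,
    MeasureTheory.Measure.addHaar_image_linearMap, hf, LinearMap.det_toLin, hdet,
    (PiLp.volume_preserving_ofLp (Fin d)).measure_preimage hT.nullMeasurableSet,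
    volume_corner_simplex, ← ENNReal.ofReal_mul (abs_nonneg _), mul_one_div]

/-! ### The triangulation given by an affine dependence. -/

/-- The square matrix whose `i`-th row consists of the indicator of `i ∈ A`, the number `1` and the
coordinates of `p i`. -/
def indicatorLift {d : ℕ} (A : Finset (Fin (d + 2)))
    (p : Fin (d + 2) → EuclideanSpace ℝ (Fin d)) : Matrix (Fin (d + 2)) (Fin (d + 2)) ℝ :=
  Matrix.of fun i => Fin.cons (if i ∈ A then 1 else 0) (Fin.cons 1 (p i))

theorem vecMul_indicatorLift {d : ℕ} (A : Finset (Fin (d + 2)))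
    (p : Fin (d + 2) → EuclideanSpace ℝ (Fin d)) {c : Fin (d + 2) → ℝ} (h0 : ∑ i, c i = 0)
    (hp : ∑ i, c i • p i = 0) :
    ∑ i, c i • indicatorLift A p i = Fin.cons (∑ i ∈ A, c i) 0 := by
  ext j
  simp only [Finset.sum_apply, Pi.smul_apply, smul_eq_mul, indicatorLift, Matrix.of_apply]
  refine Fin.cases ?_ (fun j => Fin.cases ?_ (fun j => ?_) j) j
  · simp
  · simpa using h0
  · simpa using congrArg (fun v : EuclideanSpace ℝ (Fin d) => v j) hp

/-- Replacing row `i` by the `c`-combination of all rows multiplies the determinant by `c i`. The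
new row has only its first entry nonzero, so Laplace expansion leaves the minor of the simplex that
omits `p i`. -/
theorem abs_mul_det_indicatorLift {d : ℕ} (A : Finset (Fin (d + 2)))
    (p : Fin (d + 2) → EuclideanSpace ℝ (Fin d)) {c : Fin (d + 2) → ℝ} (h0 : ∑ i, c i = 0)
    (hp : ∑ i, c i • p i = 0) (i : Fin (d + 2)) :
    |c i| * |(indicatorLift A p).det| = |∑ j ∈ A, c j| *
      |(Matrix.of fun j => (Fin.cons 1 (p (i.succAbove j)) : Fin (d + 1) → ℝ)).det| := by
  rw [← abs_mul, ← smul_eq_mul, ← Matrix.det_updateRow_sum, vecMul_indicatorLift A p h0 hp,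
    Matrix.det_succ_row _ i, Fin.sum_univ_succ]
  simp only [Matrix.updateRow_self, Fin.cons_zero, Fin.cons_succ, Pi.zero_apply, mul_zero,
    zero_mul, Finset.sum_const_zero, add_zero, abs_mul, abs_pow, abs_neg, abs_one, one_pow, one_mul]
  congr 3
  ext j k
  simp [indicatorLift]

section RadonTriangulation

variable {d : ℕ} {A : Finset (Fin (d + 2))} {p : Fin (d + 2) → EuclideanSpace ℝ (Fin d)}
  {c : Fin (d + 2) → ℝ}

/-- Subtracting a multiple `t` of `c` from the weights of a point does not move it. The smallest
ratio `w i / c i` over `A` is the `t` that first kills a weight while the others stay nonnegative.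
-/
theorem convexHull_range_subset_iUnion_facets {n : ℕ} {E : Type*} [AddCommGroup E] [Module ℝ E]
    {A : Finset (Fin (n + 1))} {p : Fin (n + 1) → E} {c : Fin (n + 1) → ℝ} (hA : A.Nonempty)
    (h0 : ∑ i, c i = 0) (hp : ∑ i, c i • p i = 0) (hpos : ∀ i ∈ A, 0 < c i)
    (hneg : ∀ i ∉ A, c i ≤ 0) :
    convexHull ℝ (Set.range p) ⊆ ⋃ i ∈ A, convexHull ℝ (Set.range (p ∘ i.succAbove)) := by
  intro x hx
  obtain ⟨w, hw0, hw1, rfl⟩ := mem_convexHull_range_iff.1 hx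
  obtain ⟨i, hi, hmin⟩ := A.exists_min_image (fun i => w i / c i) hA
  set t := w i / c i with ht
  have htc : t * c i = w i := div_mul_cancel₀ _ (hpos i hi).ne'
  have ht0 : 0 ≤ t := div_nonneg (hw0 i) (hpos i hi).le
  refine Set.mem_biUnion hi (mem_convexHull_range_iff.2
    ⟨fun j => w (i.succAbove j) - t * c (i.succAbove j), fun j => ?_, ?_, ?_⟩)
  · by_cases hj : i.succAbove j ∈ A
    · have := (le_div_iff₀ (hpos _ hj)).1 (hmin _ hj)
      linarith
    · nlinarith [hw0 (i.succAbove j), hneg _ hj]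
  · have h : ∑ j, (w j - t * c j) = 1 := by
      rw [Finset.sum_sub_distrib, ← Finset.mul_sum, hw1, h0]; ring
    rw [Fin.sum_univ_succAbove _ i, htc, sub_self, zero_add] at h
    exact h
  · have h : ∑ j, (w j - t * c j) • p j = ∑ j, w j • p j := by
      simp only [sub_smul, Finset.sum_sub_distrib, mul_smul, ← Finset.smul_sum, hp]
      simp
    rw [Fin.sum_univ_succAbove _ i, htc, sub_self, zero_smul, zero_add] at h
    exact h

theorem sum_volume_facets (hA : A.Nonempty)
    (h0 : ∑ i, c i = 0) (hp : ∑ i, c i • p i = 0) (hpos : ∀ i ∈ A, 0 < c i) :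
    ∑ i ∈ A, MeasureTheory.volume (convexHull ℝ (Set.range (p ∘ i.succAbove))) =
      ENNReal.ofReal (|(indicatorLift A p).det| / d.factorial) := by
  have hσ : 0 < ∑ i ∈ A, c i := Finset.sum_pos hpos hA
  have key : ∀ i ∈ A, MeasureTheory.volume (convexHull ℝ (Set.range (p ∘ i.succAbove))) =
      ENNReal.ofReal (c i * (|(indicatorLift A p).det| / (∑ j ∈ A, c j) / d.factorial)) := by
    intro i hi
    have h := abs_mul_det_indicatorLift A p h0 hp i
    rw [volume_convexHull_range_simplex]
    rw [abs_of_pos (hpos i hi), abs_of_pos hσ] at h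
    congr 1
    simp only [Function.comp_apply]
    field_simp
    linarith
  rw [Finset.sum_congr rfl key, ← ENNReal.ofReal_sum_of_nonneg
    fun i hi => mul_nonneg (hpos i hi).le (by positivity), ← Finset.sum_mul]
  congr 1
  field_simp

theorem volume_convexHull_le (hA : A.Nonempty)
    (h0 : ∑ i, c i = 0) (hp : ∑ i, c i • p i = 0) (hpos : ∀ i ∈ A, 0 < c i)
    (hneg : ∀ i ∉ A, c i ≤ 0) :
    MeasureTheory.volume (convexHull ℝ (Set.range p)) ≤
      ENNReal.ofReal (|(indicatorLift A p).det| / d.factorial) := by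
  rw [← sum_volume_facets hA h0 hp hpos]
  exact (MeasureTheory.measure_mono
    (convexHull_range_subset_iUnion_facets hA h0 hp hpos hneg)).trans
      (MeasureTheory.measure_biUnion_finset_le _ _)

/-- Two weight vectors `w`, `v` of a common point differ by `s • c`. Vanishing of `w` at `i` gives
`s ≤ 0` and of `v` at `k` gives `s ≥ 0`, so `s = 0` and `w` vanishes at both. The overlap lies in
the affine span of `d` points, a null set. -/
theorem aedisjoint_facets (hd : 1 ≤ d) (hA : A.Nonempty)
    (h0 : ∑ i, c i = 0) (hp : ∑ i, c i • p i = 0) (hpos : ∀ i ∈ A, 0 < c i)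
    (hdet : (indicatorLift A p).det ≠ 0) {i k : Fin (d + 2)} (hi : i ∈ A) (hk : k ∈ A)
    (hik : i ≠ k) :
    MeasureTheory.AEDisjoint MeasureTheory.volume
      (convexHull ℝ (Set.range (p ∘ i.succAbove)))
      (convexHull ℝ (Set.range (p ∘ k.succAbove))) := by
  have hσ : 0 < ∑ i ∈ A, c i := Finset.sum_pos hpos hA
  set t : Finset (Fin (d + 2)) := Finset.univ \ {i, k} with ht
  have htc : t.card = (d - 1) + 1 := by
    rw [ht, Finset.card_sdiff_of_subset (Finset.subset_univ _), Finset.card_pair hik,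
      Finset.card_univ, Fintype.card_fin]
    omega
  have ext_coeff : ∀ (i : Fin (d + 2)) (x : EuclideanSpace ℝ (Fin d)),
      x ∈ convexHull ℝ (Set.range (p ∘ i.succAbove)) →
      ∃ w : Fin (d + 2) → ℝ, w i = 0 ∧ (∀ j, 0 ≤ w j) ∧ ∑ j, w j = 1 ∧ ∑ j, w j • p j = x := by
    intro i x hx
    obtain ⟨w, hw0, hw1, rfl⟩ := mem_convexHull_range_iff.1 hx
    refine ⟨i.insertNth 0 w, by simp, fun j => ?_, ?_, ?_⟩
    · refine i.succAboveCases ?_ (fun j => ?_) j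
      · simp
      · simpa using hw0 j
    · simpa [Fin.sum_univ_succAbove _ i] using hw1
    · simp [Fin.sum_univ_succAbove _ i]
  have hsub : convexHull ℝ (Set.range (p ∘ i.succAbove)) ∩
      convexHull ℝ (Set.range (p ∘ k.succAbove)) ⊆
      affineSpan ℝ (t.image p : Set (EuclideanSpace ℝ (Fin d))) := by
    rintro x ⟨hx, hy⟩
    obtain ⟨w, hwi, hw0, hw1, hw⟩ := ext_coeff i x hx
    obtain ⟨v, hvk, hv0, hv1, hv⟩ := ext_coeff k x hy
    -- Chosen so that `w - v - s • c` sums to zero over `A`, which puts it in the left kernel of the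
    -- lift.
    set s := (∑ j ∈ A, (w j - v j)) / ∑ j ∈ A, c j with hs
    have hker : (fun j => w j - v j - s * c j) = 0 := by
      apply Matrix.eq_zero_of_vecMul_eq_zero hdet
      have h := vecMul_indicatorLift A p (c := fun j => w j - v j - s * c j)
        (by simp [Finset.sum_sub_distrib, ← Finset.mul_sum, h0, hw1, hv1])
        (by simp [sub_smul, Finset.sum_sub_distrib, mul_smul, ← Finset.smul_sum, hp, hw, hv])
      rw [Matrix.vecMul_eq_sum, h, Finset.sum_sub_distrib, ← Finset.mul_sum, hs,
        div_mul_cancel₀ _ hσ.ne', sub_self]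
      ext j
      refine Fin.cases ?_ (fun j => ?_) j <;> simp
    have e1 := congrFun hker i
    have e2 := congrFun hker k
    simp only [Pi.zero_apply, hwi, hvk] at e1 e2
    have hs0 : s = 0 := by
      rcases lt_trichotomy s 0 with h | h | h
      · nlinarith [hpos k hk, hw0 k]
      · exact h
      · nlinarith [hpos i hi, hv0 i]
    have hwk : w k = 0 := by rw [hs0] at e2; linarith
    have hz : ∀ j ∉ t, w j = 0 := by
      intro j hj
      simp only [ht, Finset.mem_sdiff, Finset.mem_univ, true_and, Finset.mem_insert,
        Finset.mem_singleton, not_not] at hj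
      rcases hj with rfl | rfl <;> assumption
    apply convexHull_subset_affineSpan
    rw [← hw, ← Finset.sum_subset (Finset.subset_univ t)
      fun j _ hj => by rw [hz j hj, zero_smul]]
    refine (convex_convexHull ℝ _).sum_mem (fun j _ => hw0 j) ?_ fun j hj =>
      subset_convexHull ℝ _ (by simpa using ⟨j, hj, rfl⟩)
    rw [← hw1, ← Finset.sum_subset (Finset.subset_univ t) fun j _ hj => hz j hj]
  refine MeasureTheory.measure_mono_null hsub
    (MeasureTheory.Measure.addHaar_affineSubspace _ _ fun htop => ?_)
  have h1 := finrank_vectorSpan_image_finset_le ℝ p t htc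
  rw [← direction_affineSpan, htop, AffineSubspace.direction_top, finrank_top,
    finrank_euclideanSpace_fin] at h1
  omega

theorem volume_convexHull_eq (hd : 1 ≤ d) (hA : A.Nonempty)
    (h0 : ∑ i, c i = 0) (hp : ∑ i, c i • p i = 0) (hpos : ∀ i ∈ A, 0 < c i)
    (hneg : ∀ i ∉ A, c i ≤ 0) (hdet : (indicatorLift A p).det ≠ 0) :
    MeasureTheory.volume (convexHull ℝ (Set.range p)) =
      ENNReal.ofReal (|(indicatorLift A p).det| / d.factorial) := by
  refine (volume_convexHull_le hA h0 hp hpos hneg).antisymm ?_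
  rw [← sum_volume_facets hA h0 hp hpos, ← MeasureTheory.measure_biUnion_finset₀
    (fun i hi k hk hik => aedisjoint_facets hd hA h0 hp hpos hdet hi hk hik)
    fun i _ => ((Set.finite_range _).isClosed_convexHull ℝ).measurableSet.nullMeasurableSet]
  exact MeasureTheory.measure_mono
    (Set.iUnion₂_subset fun i _ => convexHull_mono (Set.range_comp_subset_range _ _))

end RadonTriangulation

/-! ### Hadamard's inequality and the determinant bound. -/

/-- Hadamard's inequality for matrices with rows of length one. -/
theorem Matrix.det_sq_le_one_of_rows {n : Type*} [Fintype n] [DecidableEq n] (N : Matrix n n ℝ)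
    (hN : ∀ i, (N * N.transpose) i i = 1) : N.det ^ 2 ≤ 1 ∧ (N.det ^ 2 = 1 → N * N.transpose = 1) := by
  have hps : (N * N.transpose).PosSemidef := by
    simpa [Matrix.conjTranspose_eq_transpose_of_trivial] using
      Matrix.posSemidef_self_mul_conjTranspose N
  have hH := hps.isHermitian
  have hdet : N.det ^ 2 = ∏ i, hH.eigenvalues i := by
    have h := hH.det_eq_prod_eigenvalues
    rw [Matrix.det_mul, Matrix.det_transpose, ← sq] at h
    simpa using h
  have htr : ∑ i, (hH.eigenvalues i - 1) = 0 := by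
    have h := hH.trace_eq_sum_eigenvalues
    simp only [Matrix.trace, Matrix.diag_apply, hN] at h
    rw [Finset.sum_sub_distrib, sub_eq_zero]
    simpa using h.symm
  -- AM-GM through `x ≤ exp (x - 1)`: the trace fixes the product of the right-hand sides at `1`,
  -- and equality forces every eigenvalue to be `1`.
  have hexp : ∏ i, Real.exp (hH.eigenvalues i - 1) = 1 := by
    rw [← Real.exp_sum, htr, Real.exp_zero]
  have hle : ∀ i, hH.eigenvalues i ≤ Real.exp (hH.eigenvalues i - 1) := fun i => by
    linarith [Real.add_one_le_exp (hH.eigenvalues i - 1)]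
  refine ⟨?_, fun h1 => ?_⟩
  · rw [hdet, ← hexp]
    exact Finset.prod_le_prod (fun i _ => hps.eigenvalues_nonneg i) fun i _ => hle i
  · have hpos : ∀ i, 0 < hH.eigenvalues i := fun i => by
      refine (hps.eigenvalues_nonneg i).lt_of_ne' fun h0 => ?_
      rw [hdet, Finset.prod_eq_zero (Finset.mem_univ i) h0] at h1
      exact zero_ne_one h1
    have hone : ∀ i, hH.eigenvalues i = 1 := by
      by_contra! hex
      obtain ⟨i, hi⟩ := hex
      have hlt : ∏ i, hH.eigenvalues i < ∏ i, Real.exp (hH.eigenvalues i - 1) :=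
        Finset.prod_lt_prod (fun i _ => hpos i) (fun i _ => hle i)
          ⟨i, Finset.mem_univ i, by
            linarith [Real.add_one_lt_exp (sub_ne_zero.2 hi)]⟩
      rw [hexp, ← hdet, h1] at hlt
      exact lt_irrefl _ hlt
    have hsp := hH.spectral_theorem
    have hdiag : (Matrix.diagonal ((RCLike.ofReal : ℝ → ℝ) ∘ hH.eigenvalues)) =
        (1 : Matrix n n ℝ) := by
      rw [← Matrix.diagonal_one]
      congr 1
      ext i
      simp [hone i]
    rw [hsp, hdiag, map_one]

/-- The Gram matrix of two regular simplices with vertex sets indexed by `A` and its complement,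
of dimensions `a` and `b`, inscribed in the unit spheres of orthogonal subspaces. -/
noncomputable def crossGram {ι : Type*} [DecidableEq ι] (A : Finset ι) (a b : ℝ) (i j : ι) : ℝ :=
  if i = j then 1 else if i ∈ A then if j ∈ A then -1 / a else 0 else if j ∈ A then 0 else -1 / b

/-- The squared product of `a!` and the volume of a regular `a`-simplex inscribed in the
unit sphere. -/
noncomputable def simplexFactor (a : ℕ) : ℝ := ((a : ℝ) + 1) ^ (a + 1) / (a : ℝ) ^ a

theorem simplexFactor_pos {a : ℕ} (ha : 1 ≤ a) : 0 < simplexFactor a := by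
  have : (0 : ℝ) < a := by exact_mod_cast ha
  unfold simplexFactor
  positivity

/-- A rescaling of the rows and columns of `indicatorLift A p`; its rows are unit vectors
if the points `p i` lie on the unit sphere. -/
noncomputable def scaledLift {d : ℕ} (A : Finset (Fin (d + 2))) (a b : ℝ)
    (p : Fin (d + 2) → EuclideanSpace ℝ (Fin d)) : Matrix (Fin (d + 2)) (Fin (d + 2)) ℝ :=
  Matrix.of fun i j => √(if i ∈ A then a / (a + 1) else b / (b + 1)) *
    Matrix.of (fun i j => (Fin.cons (√a)⁻¹ (Fin.cons (√b)⁻¹ 1) : Fin (d + 2) → ℝ) j *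
      (Fin.cons (if i ∈ A then 1 else 0) (Fin.cons (if i ∈ A then 0 else 1) (p i)) :
        Fin (d + 2) → ℝ) j) i j

section ScaledLift

variable {d : ℕ} {A : Finset (Fin (d + 2))} {p : Fin (d + 2) → EuclideanSpace ℝ (Fin d)}

/-- The indicator columns add `1 / a` or `1 / b` within a block, so off-diagonal entries vanish
exactly for inner products `-1 / a`, `-1 / b` within the blocks and `0` across; the row factors
normalise `1 + 1 / a` and `1 + 1 / b` to `1`. -/
theorem scaledLift_mul_transpose {a b : ℝ} (ha : 0 < a) (hb : 0 < b) (i j : Fin (d + 2)) :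
    (scaledLift A a b p * (scaledLift A a b p).transpose) i j =
      √(if i ∈ A then a / (a + 1) else b / (b + 1)) *
      √(if j ∈ A then a / (a + 1) else b / (b + 1)) *
        ((if i ∈ A then if j ∈ A then 1 / a else 0 else if j ∈ A then 0 else 1 / b) +
          inner ℝ (p i) (p j)) := by
  have hsa : (√a)⁻¹ * (√a)⁻¹ = 1 / a := by rw [← mul_inv, Real.mul_self_sqrt ha.le, one_div]
  have hsb : (√b)⁻¹ * (√b)⁻¹ = 1 / b := by rw [← mul_inv, Real.mul_self_sqrt hb.le, one_div]
  rw [Matrix.mul_apply]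
  simp only [Matrix.transpose_apply, scaledLift, Matrix.of_apply, PiLp.inner_apply]
  rw [Fin.sum_univ_succ, Fin.sum_univ_succ]
  simp only [Fin.cons_zero, Fin.cons_succ, Pi.one_apply, one_mul]
  rw [mul_add, Finset.mul_sum, ← add_assoc]
  congr 1
  · rw [← hsa, ← hsb]
    split_ifs <;> ring
  · refine Finset.sum_congr rfl fun k _ => ?_
    simp only [RCLike.inner_apply, conj_trivial]
    ring

theorem det_scaledLift_sq {a b : ℕ} (ha : 1 ≤ a) (hb : 1 ≤ b) (hA : A.card = a + 1)
    (hab : a + b = d) :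
    (scaledLift A a b p).det ^ 2 =
      (indicatorLift A p).det ^ 2 / (simplexFactor a * simplexFactor b) := by
  have ha' : (0 : ℝ) < a := by exact_mod_cast ha
  have hb' : (0 : ℝ) < b := by exact_mod_cast hb
  have hcol : (Matrix.of fun i => (Fin.cons (if i ∈ A then 1 else 0)
      (Fin.cons (if i ∈ A then 0 else 1) (p i)) : Fin (d + 2) → ℝ)).det =
      (indicatorLift A p).det := by
    -- Adding the indicator of `A` to that of its complement gives the column of ones.
    rw [← Matrix.det_updateCol_add_self _ (show (1 : Fin (d + 2)) ≠ 0 by simp)]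
    congr 1
    ext i j
    refine Fin.cases ?_ (fun j => Fin.cases ?_ (fun j => ?_) j) j
    · rw [Matrix.updateCol_ne (by simp)]
      simp [indicatorLift]
    · have h1 : (Fin.succ 0 : Fin (d + 2)) = 1 := rfl
      rw [h1, Matrix.updateCol_self]
      simp only [Matrix.of_apply, indicatorLift, ← h1, Fin.cons_succ, Fin.cons_zero]
      split_ifs <;> simp
    · rw [Matrix.updateCol_ne (by simp [Fin.ext_iff])]
      simp [indicatorLift]
  have hAc : (Finset.univ.filter fun i => i ∉ A).card = b + 1 := by
    rw [Finset.filter_not, Finset.card_sdiff_of_subset (by simp)]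
    simp [hA]
    omega
  have hprod : (∏ i : Fin (d + 2), √(if i ∈ A then (a : ℝ) / (a + 1) else b / (b + 1))) ^ 2 =
      (a / (a + 1)) ^ (a + 1) * (b / (b + 1)) ^ (b + 1) := by
    rw [← Finset.prod_pow, Finset.prod_congr rfl fun i _ =>
      Real.sq_sqrt (by split_ifs <;> positivity), Finset.prod_ite, Finset.prod_const,
      Finset.prod_const, hAc]
    simp [hA]
  rw [scaledLift, Matrix.det_mul_column]
  have hrow := Matrix.det_mul_row (Fin.cons (√(a : ℝ))⁻¹ (Fin.cons (√(b : ℝ))⁻¹ 1))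
    (Matrix.of fun i => (Fin.cons (if i ∈ A then 1 else 0)
      (Fin.cons (if i ∈ A then 0 else 1) (p i)) : Fin (d + 2) → ℝ))
  rw [hcol] at hrow
  simp only [Matrix.of_apply] at hrow
  rw [hrow, mul_pow, hprod, mul_pow, Fin.prod_univ_succ, Fin.prod_univ_succ]
  simp only [Fin.cons_zero, Fin.cons_succ, Pi.one_apply, Finset.prod_const_one, mul_one, mul_pow,
    inv_pow, Real.sq_sqrt ha'.le, Real.sq_sqrt hb'.le, simplexFactor, div_pow]
  rw [pow_succ (a : ℝ), pow_succ (b : ℝ)]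
  field_simp

theorem det_indicatorLift_sq_le {a b : ℕ} (ha : 1 ≤ a) (hb : 1 ≤ b) (hA : A.card = a + 1)
    (hab : a + b = d) (hp : ∀ i, ‖p i‖ = 1) :
    (indicatorLift A p).det ^ 2 ≤ simplexFactor a * simplexFactor b ∧
      ((indicatorLift A p).det ^ 2 = simplexFactor a * simplexFactor b →
        ∀ i j, inner ℝ (p i) (p j) = crossGram A a b i j) := by
  have ha' : (0 : ℝ) < a := by exact_mod_cast ha
  have hb' : (0 : ℝ) < b := by exact_mod_cast hb
  have hpos := mul_pos (simplexFactor_pos ha) (simplexFactor_pos hb)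
  have hrow : ∀ i, (scaledLift A a b p * (scaledLift A a b p).transpose) i i = 1 := by
    intro i
    rw [scaledLift_mul_transpose ha' hb', Real.mul_self_sqrt (by split_ifs <;> positivity),
      real_inner_self_eq_norm_sq, hp]
    split_ifs <;> field_simp <;> ring
  have hH := Matrix.det_sq_le_one_of_rows _ hrow
  rw [det_scaledLift_sq ha hb hA hab, div_le_one hpos, div_eq_one_iff_eq hpos.ne'] at hH
  refine ⟨hH.1, fun h i j => ?_⟩
  by_cases hij : i = j
  · subst hij
    rw [real_inner_self_eq_norm_sq, hp, crossGram, if_pos rfl, one_pow]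
  · have h := congrFun (congrFun (hH.2 h) i) j
    rw [scaledLift_mul_transpose ha' hb', Matrix.one_apply_ne hij] at h
    have hne : ∀ i, √(if i ∈ A then (a : ℝ) / (a + 1) else b / (b + 1)) ≠ 0 := fun i =>
      (Real.sqrt_pos.2 (by split_ifs <;> positivity)).ne'
    have h := (mul_eq_zero.1 h).resolve_left (mul_ne_zero (hne i) (hne j))
    rw [eq_neg_of_add_eq_zero_right h, crossGram, if_neg hij]
    split_ifs <;> ring

theorem det_indicatorLift_sq_eq {a b : ℕ} (ha : 1 ≤ a) (hb : 1 ≤ b) (hA : A.card = a + 1)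
    (hab : a + b = d) (hp : ∀ i j, inner ℝ (p i) (p j) = crossGram A a b i j) :
    (indicatorLift A p).det ^ 2 = simplexFactor a * simplexFactor b := by
  have ha' : (0 : ℝ) < a := by exact_mod_cast ha
  have hb' : (0 : ℝ) < b := by exact_mod_cast hb
  have hpos := mul_pos (simplexFactor_pos ha) (simplexFactor_pos hb)
  have hone : scaledLift A a b p * (scaledLift A a b p).transpose = 1 := by
    ext i j
    rw [scaledLift_mul_transpose ha' hb', hp, crossGram]
    by_cases hij : i = j
    · subst hij
      rw [Matrix.one_apply_eq, Real.mul_self_sqrt (by split_ifs <;> positivity), if_pos rfl]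
      split_ifs <;> field_simp <;> ring
    · rw [Matrix.one_apply_ne hij, if_neg hij]
      split_ifs <;> ring
  have h := congrArg Matrix.det hone
  rwa [Matrix.det_mul, Matrix.det_transpose, ← sq, det_scaledLift_sq ha hb hA hab, Matrix.det_one,
    div_eq_one_iff_eq hpos.ne'] at h

end ScaledLift

/-! ### Optimising the pair of dimensions. -/

/-- The derivative `log (1 + 1 / x)` is strictly decreasing. At natural numbers the function is `log
simplexFactor`. -/
theorem strictConcaveOn_simplexEntropy :
    StrictConcaveOn ℝ (Set.Ioi (0 : ℝ))
      fun x => (x + 1) * Real.log (x + 1) - x * Real.log x := by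
  have hderiv : ∀ x ∈ Set.Ioi (0 : ℝ),
      HasDerivAt (fun x => (x + 1) * Real.log (x + 1) - x * Real.log x)
        (Real.log (1 + 1 / x)) x := by
    intro x hx
    have hx : 0 < x := hx
    have h1 := (Real.hasDerivAt_mul_log (x := x + 1) (by positivity)).comp x
      ((hasDerivAt_id x).add_const 1)
    have h2 := Real.hasDerivAt_mul_log hx.ne'
    refine (h1.sub h2).congr_deriv ?_
    rw [show 1 + 1 / x = (x + 1) / x by field_simp, Real.log_div (by positivity) hx.ne']
    ring
  refine StrictAntiOn.strictConcaveOn_of_deriv (convex_Ioi 0)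
    (fun x hx => (hderiv x hx).continuousAt.continuousWithinAt) ?_
  rw [interior_Ioi]
  intro x hx y hy hxy
  rw [(hderiv x hx).deriv, (hderiv y hy).deriv]
  have hx : 0 < x := hx
  have hy : 0 < y := hy
  apply Real.log_lt_log (by positivity)
  gcongr

theorem log_simplexFactor {a : ℕ} (ha : 1 ≤ a) : Real.log (simplexFactor a) =
    ((a : ℝ) + 1) * Real.log (a + 1) - a * Real.log a := by
  have ha' : (0 : ℝ) < a := by exact_mod_cast ha
  rw [simplexFactor, Real.log_div (by positivity) (by positivity), Real.log_pow, Real.log_pow]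
  push_cast
  ring

theorem simplexFactor_mul_lt {a b k m : ℕ} (hab : a ≤ b) (hk : 1 ≤ k) (hka : k < a)
    (h : k + m = a + b) :
    simplexFactor k * simplexFactor m < simplexFactor a * simplexFactor b := by
  have hk' : (0 : ℝ) < k := by exact_mod_cast hk
  have hka' : (k : ℝ) < a := by exact_mod_cast hka
  have hab' : (a : ℝ) ≤ b := by exact_mod_cast hab
  have h' : (k : ℝ) + m = a + b := by exact_mod_cast h
  have hk0 := simplexFactor_pos hk
  have hm0 := simplexFactor_pos (a := m) (by omega)
  have ha0 := simplexFactor_pos (a := a) (by omega)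
  have hb0 := simplexFactor_pos (a := b) (by omega)
  rw [← Real.log_lt_log_iff (mul_pos hk0 hm0) (mul_pos ha0 hb0),
    Real.log_mul hk0.ne' hm0.ne', Real.log_mul ha0.ne' hb0.ne', log_simplexFactor hk,
    log_simplexFactor (by omega), log_simplexFactor (by omega), log_simplexFactor (by omega)]
  have hmk : (0 : ℝ) < m - k := by linarith
  -- Since `k < a ≤ b < m` with equal sums, `a = t k + s m` and `b = s k + t m`; the two strict
  -- concavity inequalities are added.
  set s : ℝ := (a - k) / (m - k) with hs
  set t : ℝ := (m - a) / (m - k) with ht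
  have hs0 : 0 < s := div_pos (by linarith) hmk
  have ht0 : 0 < t := div_pos (by linarith) hmk
  have hst : t + s = 1 := by rw [hs, ht]; field_simp; ring
  have hsm : s * (m - k) = a - k := div_mul_cancel₀ _ hmk.ne'
  have h1 := strictConcaveOn_simplexEntropy.2 (x := k) (y := m) hk' (by simp; omega)
    (by linarith) ht0 hs0 hst
  have h2 := strictConcaveOn_simplexEntropy.2 (x := k) (y := m) hk' (by simp; omega)
    (by linarith) hs0 ht0 (by linarith)
  simp only [smul_eq_mul] at h1 h2
  have e1 : t * (k : ℝ) + s * m = a := by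
    rw [eq_sub_of_add_eq hst]; linarith
  have e2 : s * (k : ℝ) + t * m = b := by
    rw [eq_sub_of_add_eq hst]; linarith
  rw [e1] at h1
  rw [e2] at h2
  have e3 := eq_sub_of_add_eq hst
  rw [e3] at h1 h2
  linarith

theorem simplexFactor_mul_le {a b k m : ℕ} (hab : a ≤ b) (hba : b ≤ a + 1) (hk : 1 ≤ k)
    (hm : 1 ≤ m) (h : k + m = a + b) :
    simplexFactor k * simplexFactor m ≤ simplexFactor a * simplexFactor b ∧
      (simplexFactor k * simplexFactor m = simplexFactor a * simplexFactor b → k = a ∨ m = a) := by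
  rcases lt_or_ge k a with hka | hka
  · have := simplexFactor_mul_lt hab hk hka h
    exact ⟨this.le, fun he => absurd he this.ne⟩
  rcases lt_or_ge m a with hma | hma
  · have := simplexFactor_mul_lt hab hm hma (by omega : m + k = a + b)
    rw [mul_comm (simplexFactor m)] at this
    exact ⟨this.le, fun he => absurd he this.ne⟩
  have hor : (k = a ∧ m = b) ∨ (m = a ∧ k = b) := by omega
  rcases hor with ⟨rfl, rfl⟩ | ⟨rfl, rfl⟩
  · exact ⟨le_rfl, fun _ => Or.inl rfl⟩
  · exact ⟨(mul_comm _ _).le, fun _ => Or.inr rfl⟩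

theorem sqrt_simplexFactor (a : ℕ) :
    √(simplexFactor a) = ((a : ℝ) + 1) ^ (((a : ℝ) + 1) / 2) / (a : ℝ) ^ ((a : ℝ) / 2) := by
  rw [simplexFactor, Real.sqrt_div (by positivity), Real.sqrt_eq_rpow, Real.sqrt_eq_rpow,
    ← Real.rpow_natCast_mul (by positivity), ← Real.rpow_natCast_mul (by positivity)]
  push_cast
  simp only [mul_one_div]

theorem sqrt_simplexFactor_mul (a b : ℕ) :
    √(simplexFactor a * simplexFactor b) =
      (((a : ℝ) + 1) ^ (((a : ℝ) + 1) / 2) * ((b : ℝ) + 1) ^ (((b : ℝ) + 1) / 2)) /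
          ((a : ℝ) ^ ((a : ℝ) / 2) * (b : ℝ) ^ ((b : ℝ) / 2)) := by
  rw [Real.sqrt_mul (by unfold simplexFactor; positivity), sqrt_simplexFactor, sqrt_simplexFactor,
    div_mul_div_comm]

/-! ### Regular simplices and their Gram matrices. -/

open scoped InnerProductSpace in
theorem Affine.Simplex.regular_of_inner_eq {E : Type*} [NormedAddCommGroup E]
    [InnerProductSpace ℝ E] {n : ℕ} (S : Affine.Simplex ℝ E n) {r t : ℝ}
    (h : ∀ i j, ⟪S.points i, S.points j⟫_ℝ = if i = j then r else t) : S.Regular := by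
  intro σ
  induction σ using Equiv.Perm.swap_induction_on' with
  | one => exact ⟨IsometryEquiv.refl E, rfl⟩
  | mul_swap f i j hij ih =>
    obtain ⟨x, hx⟩ := ih
    -- This reflection swaps vertices `i` and `j` and fixes every other vertex, whose inner products
    -- with these two agree. Transpositions generate all permutations.
    set R := (ℝ ∙ (S.points i - S.points j))ᗮ.reflection
    have hn : ∀ i, ‖S.points i‖ ^ 2 = r := fun i => by
      rw [← real_inner_self_eq_norm_sq, h, if_pos rfl]
    have hij' : ‖S.points i‖ = ‖S.points j‖ :=
      (sq_eq_sq₀ (norm_nonneg _) (norm_nonneg _)).1 ((hn i).trans (hn j).symm)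
    have hR1 : R (S.points i) = S.points j := Submodule.reflection_sub hij'
    have hR2 : R (S.points j) = S.points i := by
      rw [← hR1]
      exact Submodule.reflection_reflection _ _
    refine ⟨R.toIsometryEquiv.trans x, ?_⟩
    ext k
    have hxk : ∀ l, S.points (f l) = x (S.points l) := fun l => congrFun hx l
    simp only [Equiv.Perm.coe_mul, Function.comp_apply, hxk]
    change x _ = x (R (S.points k))
    refine congrArg x ?_
    by_cases hki : k = i
    · rw [hki, Equiv.swap_apply_left, hR1]
    by_cases hkj : k = j
    · rw [hkj, Equiv.swap_apply_right, hR2]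
    rw [Equiv.swap_apply_of_ne_of_ne hki hkj]
    refine (Submodule.reflection_mem_subspace_eq_self ?_).symm
    rw [Submodule.mem_orthogonal_singleton_iff_inner_right, inner_sub_left, h, h,
      if_neg (Ne.symm hki), if_neg (Ne.symm hkj), sub_self]

theorem affineIndependent_of_inner_eq {E : Type*} [NormedAddCommGroup E]
    [InnerProductSpace ℝ E] {ι : Type*} {v : ι → E} {r t : ℝ} (hrt : r ≠ t)
    (h : ∀ i j, inner ℝ (v i) (v j) = open Classical in if i = j then r else t) :
    AffineIndependent ℝ v := by
  classical
  rw [affineIndependent_iff]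
  intro s w hw0 hw i hi
  have h1 : inner ℝ (∑ j ∈ s, w j • v j) (v i) = 0 := by rw [hw, inner_zero_left]
  have h2 : ∀ j, w j * inner ℝ (v j) (v i) = t * w j + if j = i then (r - t) * w i else 0 := by
    intro j
    rw [h]
    split_ifs with hj
    · subst hj; ring
    · ring
  simp only [sum_inner, real_inner_smul_left, h2, Finset.sum_add_distrib, ← Finset.mul_sum, hw0,
    Finset.sum_ite_eq', hi, if_true] at h1
  simpa [sub_eq_zero, hrt] using h1

section CrossGram

variable {d a b : ℕ} {A : Finset (Fin (d + 2))} {p : Fin (d + 2) → EuclideanSpace ℝ (Fin d)}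

theorem crossGram_compl {ι : Type*} [Fintype ι] [DecidableEq ι] (A : Finset ι) (a b : ℝ)
    (i j : ι) : crossGram Aᶜ b a i j = crossGram A a b i j := by
  unfold crossGram
  simp only [Finset.mem_compl]
  split_ifs <;> rfl

/-- This reverses the Hadamard argument: the normalised indicators of `A` and its complement extend
to an orthonormal basis of `ℝ^(d+2)`, and the `i`-th coordinates of the other `d` basis vectors,
rescaled, form `p i`. -/
theorem exists_inner_eq_crossGram (ha : 1 ≤ a) (hb : 1 ≤ b) (hab : a + b = d)
    (hA : A.card = a + 1) :
    ∃ p : Fin (d + 2) → EuclideanSpace ℝ (Fin d),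
      ∀ i j, inner ℝ (p i) (p j) = crossGram A a b i j := by
  have ha' : (0 : ℝ) < a := by exact_mod_cast ha
  have hb' : (0 : ℝ) < b := by exact_mod_cast hb
  have hAc : Aᶜ.card = b + 1 := by
    rw [Finset.card_compl, hA, Fintype.card_fin]; omega
  -- Only `u 0` and `u 1` matter; the remaining zeros are placeholders.
  set u : Fin (d + 2) → EuclideanSpace ℝ (Fin (d + 2)) :=
    Fin.cons (WithLp.toLp 2 fun i => if i ∈ A then (√(a + 1 : ℝ))⁻¹ else 0)
      (Fin.cons (WithLp.toLp 2 fun i => if i ∈ A then 0 else (√(b + 1 : ℝ))⁻¹) 0) with hu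
  have hua : (√(a + 1 : ℝ))⁻¹ * (√(a + 1 : ℝ))⁻¹ = ((a : ℝ) + 1)⁻¹ := by
    rw [← mul_inv, Real.mul_self_sqrt (by positivity)]
  have hub : (√(b + 1 : ℝ))⁻¹ * (√(b + 1 : ℝ))⁻¹ = ((b : ℝ) + 1)⁻¹ := by
    rw [← mul_inv, Real.mul_self_sqrt (by positivity)]
  have h01 : (1 : Fin (d + 2)) = Fin.succ 0 := rfl
  have hAc' : (Finset.univ.filter fun i => i ∉ A).card = b + 1 := by
    rw [← hAc]; congr 1; ext; simp
  have horth : Orthonormal ℝ (({0, 1} : Set (Fin (d + 2))).domRestrict u) := by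
    rw [orthonormal_iff_ite]
    have h00 : inner ℝ (u 0) (u 0) = (1 : ℝ) := by
      rw [PiLp.inner_apply]
      simp [hu, hua, hA, -inner_self_eq_norm_sq_to_K]
      field_simp
    have h11 : inner ℝ (u 1) (u 1) = (1 : ℝ) := by
      rw [PiLp.inner_apply, h01]
      simp only [hu, Fin.cons_succ, Fin.cons_zero]
      simp only [RCLike.inner_apply, conj_trivial, ite_mul, zero_mul, mul_ite, mul_zero, hub]
      rw [Finset.sum_congr rfl (g := fun i => if i ∉ A then ((b : ℝ) + 1)⁻¹ else 0)
        fun i _ => by split_ifs <;> rfl, ← Finset.sum_filter, Finset.sum_const, hAc']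
      simp
      field_simp
    have h10 : inner ℝ (u 1) (u 0) = (0 : ℝ) := by
      rw [PiLp.inner_apply, h01]
      simp only [hu, Fin.cons_succ, Fin.cons_zero]
      refine Finset.sum_eq_zero fun i _ => ?_
      split_ifs <;> simp
    have h10' : (1 : Fin (d + 2)) ≠ 0 := by simp
    rintro ⟨i, hi⟩ ⟨j, hj⟩
    simp only [Set.domRestrict_apply, Subtype.mk.injEq]
    rcases hi with rfl | hi <;> rcases hj with rfl | hj
    · rw [if_pos rfl, h00]
    · rw [Set.mem_singleton_iff.1 hj, if_neg h10'.symm, real_inner_comm, h10]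
    · rw [Set.mem_singleton_iff.1 hi, if_neg h10', h10]
    · rw [Set.mem_singleton_iff.1 hi, Set.mem_singleton_iff.1 hj, if_pos rfl, h11]
  obtain ⟨B, hB⟩ := horth.exists_orthonormalBasis_extension_of_card_eq (by simp)
  have hB0 : B 0 = u 0 := hB 0 (by simp)
  have hB1 : B (Fin.succ 0) = u (Fin.succ 0) := hB 1 (by simp)
  refine ⟨fun i => WithLp.toLp 2 fun j =>
    (√(if i ∈ A then (a : ℝ) / (a + 1) else b / (b + 1)))⁻¹ * B j.succ.succ i, fun i k => ?_⟩
  -- Parseval for standard basis vectors: the rows of the orthogonal matrix are orthonormal too.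
  have hsum := B.sum_inner_mul_inner (EuclideanSpace.single i (1 : ℝ)) (EuclideanSpace.single k 1)
  simp only [EuclideanSpace.inner_single_left, EuclideanSpace.inner_single_right, map_one,
    conj_trivial, one_mul, PiLp.single_apply] at hsum
  rw [Fin.sum_univ_succ, Fin.sum_univ_succ, hB0, hB1, ← add_assoc, ← eq_sub_iff_add_eq'] at hsum
  simp only [hu, Fin.cons_zero, Fin.cons_succ] at hsum
  rw [PiLp.inner_apply]
  simp only [RCLike.inner_apply, conj_trivial]
  rw [Finset.sum_congr rfl fun j _ => show _ =
    (√(if i ∈ A then (a : ℝ) / (a + 1) else b / (b + 1)))⁻¹ *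
    (√(if k ∈ A then (a : ℝ) / (a + 1) else b / (b + 1)))⁻¹ *
      (B j.succ.succ i * B j.succ.succ k) by ring, ← Finset.mul_sum, hsum, crossGram]
  by_cases hik : i = k
  · subst hik
    rw [← mul_inv, Real.mul_self_sqrt (by split_ifs <;> positivity)]
    split_ifs <;> simp only [hua, hub, mul_zero, add_zero, zero_add] <;> field_simp <;> simp
  · have hra : (√((a : ℝ) / (a + 1)))⁻¹ * (√((a : ℝ) / (a + 1)))⁻¹ = ((a : ℝ) + 1) / a := by
      rw [← mul_inv, Real.mul_self_sqrt (by positivity), inv_div]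
    have hrb : (√((b : ℝ) / (b + 1)))⁻¹ * (√((b : ℝ) / (b + 1)))⁻¹ = ((b : ℝ) + 1) / b := by
      rw [← mul_inv, Real.mul_self_sqrt (by positivity), inv_div]
    simp only [if_neg hik, if_neg (Ne.symm hik)]
    split_ifs <;> simp only [hua, hub, hra, hrb, mul_zero, zero_mul, add_zero, zero_add, sub_zero,
      zero_sub, mul_neg]
    · field_simp
    · field_simp

theorem sum_eq_zero_of_inner_eq_crossGram (ha : 1 ≤ a) (hA : A.card = a + 1)
    (hp : ∀ i j, inner ℝ (p i) (p j) = crossGram A a b i j) : ∑ i ∈ A, p i = 0 := by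
  have ha' : (a : ℝ) ≠ 0 := by positivity
  rw [← inner_self_eq_zero (𝕜 := ℝ), sum_inner]
  refine Finset.sum_eq_zero fun i hi => ?_
  rw [inner_sum, ← Finset.add_sum_erase _ _ hi, hp, Finset.sum_congr rfl (g := fun _ => -1 / (a : ℝ))]
  · rw [Finset.sum_const, Finset.card_erase_of_mem hi, hA, crossGram, if_pos rfl]
    simp
    field_simp
    ring
  · intro j hj
    rw [hp, crossGram, if_neg (Finset.ne_of_mem_erase hj).symm, if_pos hi,
      if_pos (Finset.mem_of_mem_erase hj)]

theorem exists_simplex_of_inner_eq (ha : 1 ≤ a) (hA : A.card = a + 1)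
    (hp : ∀ i j, inner ℝ (p i) (p j) = crossGram A a b i j) :
    ∃ S : Affine.Simplex ℝ (EuclideanSpace ℝ (Fin d)) a,
      S.Regular ∧ (∀ i, S.points i ∈ Metric.sphere 0 1) ∧ Set.range S.points = p '' A := by
  classical
  have h : ∀ i j, inner ℝ (p (A.orderEmbOfFin hA i)) (p (A.orderEmbOfFin hA j)) =
      if i = j then 1 else -1 / (a : ℝ) := by
    intro i j
    rw [hp, crossGram, if_pos (A.orderEmbOfFin_mem hA i), if_pos (A.orderEmbOfFin_mem hA j)]
    simp only [EmbeddingLike.apply_eq_iff_eq]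
  have hne : (1 : ℝ) ≠ -1 / a := by
    have : (0 : ℝ) < a := by exact_mod_cast ha
    have : -1 / (a : ℝ) < 0 := div_neg_of_neg_of_pos (by norm_num) this
    linarith
  refine ⟨⟨fun i => p (A.orderEmbOfFin hA i), affineIndependent_of_inner_eq hne
    fun i j => by rw [h]; congr⟩, Affine.Simplex.regular_of_inner_eq _ h, fun i => ?_, ?_⟩
  · have h1 := h i i
    rw [real_inner_self_eq_norm_sq, if_pos rfl] at h1
    rw [mem_sphere_zero_iff_norm]
    exact (pow_eq_one_iff_of_nonneg (norm_nonneg _) two_ne_zero).1 h1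
  · rw [← Finset.range_orderEmbOfFin A hA, ← Set.range_comp]
    rfl

theorem exists_orthogonal_regular_simplices (ha : 1 ≤ a) (hb : 1 ≤ b) (hab : a + b = d)
    (hA : A.card = a + 1) (hp : ∀ i j, inner ℝ (p i) (p j) = crossGram A a b i j) :
    ∃ (P₁ : Affine.Simplex ℝ (EuclideanSpace ℝ (Fin d)) a)
      (P₂ : Affine.Simplex ℝ (EuclideanSpace ℝ (Fin d)) b)
      (L₁ L₂ : Submodule ℝ (EuclideanSpace ℝ (Fin d))),
      P₁.Regular ∧ P₂.Regular ∧
      (∀ i, P₁.points i ∈ Metric.sphere 0 1) ∧ (∀ i, P₂.points i ∈ Metric.sphere 0 1) ∧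
      L₁.IsOrtho L₂ ∧ P₁.closedInterior ⊆ L₁ ∧ P₂.closedInterior ⊆ L₂ ∧
      convexHull ℝ (Set.range p) = convexHull ℝ (P₁.closedInterior ∪ P₂.closedInterior) := by
  have hAc : Aᶜ.card = b + 1 := by
    rw [Finset.card_compl, hA, Fintype.card_fin]; omega
  obtain ⟨P₁, h1r, h1s, h1p⟩ := exists_simplex_of_inner_eq ha hA hp
  obtain ⟨P₂, h2r, h2s, h2p⟩ := exists_simplex_of_inner_eq (b := a) hb hAc
    fun i j => by rw [hp, crossGram_compl]
  refine ⟨P₁, P₂, Submodule.span ℝ (p '' A), Submodule.span ℝ (p '' (Aᶜ : Finset _)), h1r, h2r,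
    h1s, h2s, ?_, ?_, ?_, ?_⟩
  · rw [Submodule.isOrtho_span]
    rintro _ ⟨i, hi, rfl⟩ _ ⟨j, hj, rfl⟩
    have hi : i ∈ A := hi
    have hj : j ∉ A := by simpa using hj
    rw [hp, crossGram, if_neg (by rintro rfl; exact hj hi), if_pos hi, if_neg hj]
  · rw [← P₁.convexHull_eq_closedInterior, h1p]
    exact convexHull_min Submodule.subset_span (Submodule.convex _)
  · rw [← P₂.convexHull_eq_closedInterior, h2p]
    exact convexHull_min Submodule.subset_span (Submodule.convex _)
  · rw [← P₁.convexHull_eq_closedInterior, ← P₂.convexHull_eq_closedInterior, h1p, h2p]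
    apply Set.Subset.antisymm
    · refine convexHull_mono ?_
      rintro _ ⟨i, rfl⟩
      by_cases hi : i ∈ A
      · exact Or.inl (subset_convexHull ℝ _ ⟨i, hi, rfl⟩)
      · exact Or.inr (subset_convexHull ℝ _ ⟨i, by simpa using hi, rfl⟩)
    · exact convexHull_min (Set.union_subset (convexHull_mono (Set.image_subset_range _ _))
        (convexHull_mono (Set.image_subset_range _ _))) (convex_convexHull ℝ _)

end CrossGram

/-! ### Affine dependences of points on the sphere. -/

section Dependence

theorem exists_affine_dependence {d : ℕ} (p : Fin (d + 2) → EuclideanSpace ℝ (Fin d)) :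
    ∃ c : Fin (d + 2) → ℝ, c ≠ 0 ∧ ∑ i, c i = 0 ∧ ∑ i, c i • p i = 0 := by
  let f : (Fin (d + 2) → ℝ) →ₗ[ℝ] ℝ × EuclideanSpace ℝ (Fin d) :=
    (∑ i, LinearMap.proj i).prod (Fintype.linearCombination ℝ p)
  obtain ⟨c, hc, hc0⟩ := (Submodule.ne_bot_iff _).1
    (f.ker_ne_bot_of_finrank_lt (by simp; omega))
  have h := LinearMap.mem_ker.1 hc
  refine ⟨c, hc0, ?_, ?_⟩
  · simpa [f] using congrArg Prod.fst h
  · simpa [f, Fintype.linearCombination_apply] using congrArg Prod.snd h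

/-- If only `c i` could be positive, then `∑ c j (1 - ⟪p i, p j⟫) = 0` would have only nonpositive
terms. The second factor is positive for `j ≠ i`, so `c` would vanish. -/
theorem two_le_card_pos_of_affine_dependence {E ι : Type*} [NormedAddCommGroup E]
    [InnerProductSpace ℝ E] [Fintype ι] [Nonempty ι] {p : ι → E} (hinj : Function.Injective p)
    (hp : ∀ i, ‖p i‖ = 1) {c : ι → ℝ} (hc : c ≠ 0) (h0 : ∑ i, c i = 0)
    (h1 : ∑ i, c i • p i = 0) : 2 ≤ (Finset.univ.filter fun i => 0 < c i).card := by
  classical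
  by_contra! hcard
  obtain ⟨i, hi⟩ := Finset.card_le_one_iff_subset_singleton.1 (Nat.lt_succ_iff.1 hcard)
  have hneg : ∀ j, j ≠ i → c j ≤ 0 := by
    intro j hj
    by_contra! h
    exact hj (Finset.mem_singleton.1 (hi (by simpa using h)))
  have hlt : ∀ j, j ≠ i → inner ℝ (p i) (p j) < (1 : ℝ) := fun j hj =>
    (inner_lt_one_iff_real_of_norm_eq_one (hp i) (hp j)).2 fun h => hj (hinj h).symm
  have hle : ∀ j, c j * (1 - inner ℝ (p i) (p j)) ≤ 0 := by
    intro j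
    by_cases hj : j = i
    · subst hj
      rw [real_inner_self_eq_norm_sq, hp]
      simp
    · exact mul_nonpos_of_nonpos_of_nonneg (hneg j hj) (by linarith [hlt j hj])
  have hsum : ∑ j, c j * (1 - inner ℝ (p i) (p j)) = 0 := by
    have : inner ℝ (p i) (∑ j, c j • p j) = (0 : ℝ) := by rw [h1, inner_zero_right]
    simp only [inner_sum, real_inner_smul_right] at this
    simp only [mul_sub, mul_one, Finset.sum_sub_distrib, h0, this, sub_self]
  have hz : ∀ j, j ≠ i → c j = 0 := by
    intro j hj
    have h := (Finset.sum_eq_zero_iff_of_nonpos fun j _ => hle j).1 hsum j (Finset.mem_univ j)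
    exact (mul_eq_zero.1 h).resolve_right (by linarith [hlt j hj])
  apply hc
  ext j
  by_cases hj : j = i
  · subst hj
    rwa [Fintype.sum_eq_single j hz] at h0
  · exact hz j hj

end Dependence

/-! ### Inscribed polytopes, the bound and its attainment. -/

theorem exists_vertices_of_mem_inscribedPolytopes {d n : ℕ} {P : Set (EuclideanSpace ℝ (Fin d))}
    (hn : n ≠ 0) (hP : P ∈ inscribedPolytopes d n) :
    ∃ p : Fin n → EuclideanSpace ℝ (Fin d), Function.Injective p ∧ (∀ i, ‖p i‖ = 1) ∧
      P = convexHull ℝ (Set.range p) := by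
  obtain ⟨⟨S, hS⟩, -, hcard, hsph⟩ := hP
  -- `Set.ncard` is `0` on infinite sets, so a nonzero count gives finiteness.
  have hfin : (P.extremePoints ℝ).Finite := Set.finite_of_ncard_ne_zero (hcard ▸ hn)
  have hcompact : IsCompact P := by
    rw [hS]
    exact S.finite_toSet.isCompact_convexHull ℝ
  have hconv : Convex ℝ P := by
    rw [hS]
    exact convex_convexHull ℝ _
  have hhull : P = convexHull ℝ (P.extremePoints ℝ) := by
    conv_lhs => rw [← closure_convexHull_extremePoints hcompact hconv]
    exact (hfin.isClosed_convexHull ℝ).closure_eq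
  have := hfin.fintype
  let e : Fin n ≃ P.extremePoints ℝ := (Finite.equivFinOfCardEq (by rwa [Nat.card_coe_set_eq])).symm
  refine ⟨fun i => e i, Subtype.val_injective.comp e.injective, fun i => ?_, ?_⟩
  · simpa using hsph (e i).2
  · conv_lhs => rw [hhull]
    congr 1
    rw [show (fun i => (e i : EuclideanSpace ℝ (Fin d))) = Subtype.val ∘ e from rfl,
      e.surjective.range_comp, Subtype.range_coe]

theorem convexHull_range_mem_inscribedPolytopes {d n : ℕ} {p : Fin n → EuclideanSpace ℝ (Fin d)}
    (hinj : Function.Injective p) (hp : ∀ i, ‖p i‖ = 1)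
    (hvol : MeasureTheory.volume (convexHull ℝ (Set.range p)) ≠ 0) :
    convexHull ℝ (Set.range p) ∈ inscribedPolytopes d n := by
  classical
  have hext : (convexHull ℝ (Set.range p)).extremePoints ℝ = Set.range p := by
    refine extremePoints_convexHull_subset.antisymm ?_
    have hsub : convexHull ℝ (Set.range p) ⊆ Metric.closedBall 0 1 := by
      refine convexHull_min ?_ (convex_closedBall 0 1)
      rintro _ ⟨i, rfl⟩
      simp [hp i]
    rintro _ ⟨i, rfl⟩
    -- Points of the sphere are extreme in the ball, hence in any subset of it that contains them.
    refine inter_extremePoints_subset_extremePoints_of_subset hsub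
      ⟨subset_convexHull ℝ _ ⟨i, rfl⟩, ?_⟩
    exact StrictConvexSpace.sphere_subset_extremePoints_closedBall 0 one_ne_zero (by simp [hp i])
  refine ⟨⟨Finset.univ.image p, by simp⟩, ?_, ?_, ?_⟩
  · by_contra htop
    exact hvol (MeasureTheory.measure_mono_null (subset_affineSpan ℝ _)
      (MeasureTheory.Measure.addHaar_affineSubspace _ _ htop))
  · rw [hext, ← Set.image_univ, Set.ncard_image_of_injective _ hinj, Set.ncard_univ, Nat.card_fin]
  · rw [hext]
    rintro _ ⟨i, rfl⟩
    simp [hp i]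

theorem volume_le_of_mem_inscribedPolytopes {d : ℕ} {P : Set (EuclideanSpace ℝ (Fin d))}
    {a b : ℕ} (hab : a ≤ b) (hba : b ≤ a + 1) (h : a + b = d) (ha : 1 ≤ a)
    (hP : P ∈ inscribedPolytopes d (d + 2)) :
    MeasureTheory.volume.real P ≤ √(simplexFactor a * simplexFactor b) / d.factorial ∧
      (MeasureTheory.volume.real P = √(simplexFactor a * simplexFactor b) / d.factorial →
        ∃ (A : Finset (Fin (d + 2))) (p : Fin (d + 2) → EuclideanSpace ℝ (Fin d)),
          A.card = a + 1 ∧ (∀ i j, inner ℝ (p i) (p j) = crossGram A a b i j) ∧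
          P = convexHull ℝ (Set.range p)) := by
  obtain ⟨p, hinj, hp, rfl⟩ := exists_vertices_of_mem_inscribedPolytopes (by omega) hP
  obtain ⟨c, hc, h0, h1⟩ := exists_affine_dependence p
  set A := Finset.univ.filter fun i => 0 < c i with hA
  have hA2 : 2 ≤ A.card := two_le_card_pos_of_affine_dependence hinj hp hc h0 h1
  -- The positive indices of `-c` lie in `Aᶜ`, which also holds the zeros of `c`.
  have hAc2 : 2 ≤ Aᶜ.card := by
    refine (two_le_card_pos_of_affine_dependence hinj hp (c := -c) (neg_ne_zero.2 hc)
      (by simpa using h0) (by simpa using h1)).trans (Finset.card_le_card fun i hi => ?_)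
    simp only [Pi.neg_apply, Finset.mem_filter, Finset.mem_univ, true_and, Finset.mem_compl,
      hA] at hi ⊢
    linarith
  obtain ⟨k, hk⟩ : ∃ k, A.card = k + 1 := ⟨A.card - 1, by omega⟩
  obtain ⟨m, hm⟩ : ∃ m, Aᶜ.card = m + 1 := ⟨Aᶜ.card - 1, by omega⟩
  have hkm : k + m = d := by
    have := A.card_add_card_compl
    rw [Fintype.card_fin] at this
    omega
  have hvol := volume_convexHull_le (A := A) (Finset.card_pos.1 (by omega)) h0 h1
    (fun i hi => by simpa [hA] using hi) (fun i hi => by simpa [hA] using hi)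
  have hvol' := ENNReal.toReal_le_of_le_ofReal (by positivity) hvol
  have hdet := det_indicatorLift_sq_le (by omega : 1 ≤ k) (by omega : 1 ≤ m) hk hkm hp
  have hfac := simplexFactor_mul_le hab hba (by omega : 1 ≤ k) (by omega : 1 ≤ m) (hkm.trans h.symm)
  have hsq : |(indicatorLift A p).det| ≤ √(simplexFactor a * simplexFactor b) :=
    Real.abs_le_sqrt (hdet.1.trans hfac.1)
  have hd0 : (0 : ℝ) < d.factorial := by positivity
  refine ⟨hvol'.trans (by gcongr), fun heq => ?_⟩
  have hge : √(simplexFactor a * simplexFactor b) ≤ |(indicatorLift A p).det| := by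
    have : MeasureTheory.volume.real (convexHull ℝ (Set.range p)) ≤
      |(indicatorLift A p).det| / d.factorial := hvol'
    rw [heq] at this
    exact (div_le_div_iff_of_pos_right hd0).1 this
  have heq2 : (indicatorLift A p).det ^ 2 = simplexFactor a * simplexFactor b := by
    rw [← sq_abs, hsq.antisymm hge, Real.sq_sqrt]
    exact (mul_pos (simplexFactor_pos ha) (simplexFactor_pos (ha.trans hab))).le
  have hkm' : simplexFactor k * simplexFactor m = simplexFactor a * simplexFactor b :=
    hfac.1.antisymm (heq2 ▸ hdet.1)
  have hG := hdet.2 (heq2.trans hkm'.symm)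
  -- When `m = a`, the smaller simplex sits on `Aᶜ`, so the two blocks are exchanged.
  rcases hfac.2 hkm' with rfl | rfl
  · obtain rfl : m = b := by omega
    exact ⟨A, p, hk, hG, rfl⟩
  · obtain rfl : k = b := by omega
    exact ⟨Aᶜ, p, hm, fun i j => by rw [hG, crossGram_compl], rfl⟩

/-- Both regular simplices have barycentre `0`, so the weights `1 / (a + 1)` on `A` and `-1 / (b +
1)` off `A` form an affine dependence, and the triangulation formula is exact. -/
theorem exists_mem_inscribedPolytopes_volume_eq {d a b : ℕ} (ha : 1 ≤ a) (hb : 1 ≤ b)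
    (hab : a + b = d) :
    ∃ P ∈ inscribedPolytopes d (d + 2),
      MeasureTheory.volume.real P = √(simplexFactor a * simplexFactor b) / d.factorial := by
  obtain ⟨A, -, hA⟩ := Finset.exists_subset_card_eq
    (show a + 1 ≤ (Finset.univ : Finset (Fin (d + 2))).card by rw [Finset.card_fin]; omega)
  obtain ⟨p, hp⟩ := exists_inner_eq_crossGram ha hb hab hA
  have hAc : Aᶜ.card = b + 1 := by
    rw [Finset.card_compl, hA, Fintype.card_fin]; omega
  have hAc' : (Finset.univ.filter fun i => i ∉ A).card = b + 1 := by
    rw [← hAc]; congr 1; ext; simp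
  have hs1 := sum_eq_zero_of_inner_eq_crossGram ha hA hp
  have hs2 := sum_eq_zero_of_inner_eq_crossGram (b := a) hb hAc
    fun i j => by rw [hp, crossGram_compl]
  have hF := mul_pos (simplexFactor_pos ha) (simplexFactor_pos hb)
  have hdet := det_indicatorLift_sq_eq ha hb hA hab hp
  have hdet0 : (indicatorLift A p).det ≠ 0 := fun h => by
    rw [h] at hdet
    norm_num at hdet
    rcases hdet with h | h
    · exact (simplexFactor_pos ha).ne' h
    · exact (simplexFactor_pos hb).ne' h
  have hnorm : ∀ i, ‖p i‖ = 1 := fun i => by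
    have h := hp i i
    rw [real_inner_self_eq_norm_sq, crossGram, if_pos rfl] at h
    exact (pow_eq_one_iff_of_nonneg (norm_nonneg _) two_ne_zero).1 h
  have hinj : Function.Injective p := by
    intro i j hij
    by_contra hne
    have h := hp i j
    rw [← hij, hp, crossGram, if_pos rfl, crossGram, if_neg hne] at h
    have ha' : (0 : ℝ) < a := by exact_mod_cast ha
    have hb' : (0 : ℝ) < b := by exact_mod_cast hb
    have ha2 : -1 / (a : ℝ) < 0 := div_neg_of_neg_of_pos (by norm_num) ha'
    have hb2 : -1 / (b : ℝ) < 0 := div_neg_of_neg_of_pos (by norm_num) hb'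
    split_ifs at h <;> linarith
  have hvol := volume_convexHull_eq (A := A) (p := p)
    (c := fun i => if i ∈ A then ((a : ℝ) + 1)⁻¹ else -((b : ℝ) + 1)⁻¹) (by omega)
    (Finset.card_pos.1 (by omega))
    (by
      rw [Finset.sum_ite, Finset.sum_const, Finset.sum_const, hAc']
      simp [hA]
      field_simp
      simp)
    (by
      simp only [ite_smul]
      rw [Finset.sum_ite, ← Finset.smul_sum, ← Finset.smul_sum]
      have e1 : (Finset.univ.filter fun i => i ∈ A) = A := by ext; simp
      have e2 : (Finset.univ.filter fun i => i ∉ A) = Aᶜ := by ext; simp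
      rw [e1, e2, hs1, hs2]
      simp)
    (fun i hi => by simp only [if_pos hi]; positivity)
    (fun i hi => by simp only [if_neg hi]; exact neg_nonpos.2 (by positivity)) hdet0
  have habs : |(indicatorLift A p).det| = √(simplexFactor a * simplexFactor b) := by
    rw [← hdet, Real.sqrt_sq_eq_abs]
  rw [habs] at hvol
  refine ⟨_, convexHull_range_mem_inscribedPolytopes hinj hnorm ?_, ?_⟩
  · rw [hvol]
    exact (ENNReal.ofReal_pos.2 (by positivity)).ne'
  · rw [MeasureTheory.measureReal_def, hvol, ENNReal.toReal_ofReal (by positivity)]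

theorem mainTheorem1 (d : ℕ) (hd : 2 ≤ d) (a b : ℕ)
    (ha : a = ⌊(d : ℝ) / 2⌋₊) (hb : b = ⌈(d : ℝ) / 2⌉₊) :
    (∀ P ∈ inscribedPolytopes d (d + 2),
      (∀ Q ∈ inscribedPolytopes d (d + 2),
        MeasureTheory.volume.real Q ≤ MeasureTheory.volume.real P) →
      ∃ (P₁ : Affine.Simplex ℝ (EuclideanSpace ℝ (Fin d)) a)
        (P₂ : Affine.Simplex ℝ (EuclideanSpace ℝ (Fin d)) b)
        (L₁ L₂ : Submodule ℝ (EuclideanSpace ℝ (Fin d))),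
        P₁.Regular ∧ P₂.Regular ∧
        (∀ i, P₁.points i ∈ Metric.sphere 0 1) ∧ (∀ i, P₂.points i ∈ Metric.sphere 0 1) ∧
        L₁.IsOrtho L₂ ∧
        P₁.closedInterior ⊆ L₁ ∧ P₂.closedInterior ⊆ L₂ ∧
        P = convexHull ℝ (P₁.closedInterior ∪ P₂.closedInterior)) ∧
    IsGreatest (inscribedVolumes d (d + 2)) (maxInscribedVolume d (d + 2)) ∧
    maxInscribedVolume d (d + 2) =
      1 / (d.factorial : ℝ) *
        ((((a : ℝ) + 1) ^ (((a : ℝ) + 1) / 2) * ((b : ℝ) + 1) ^ (((b : ℝ) + 1) / 2)) /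
          ((a : ℝ) ^ ((a : ℝ) / 2) * (b : ℝ) ^ ((b : ℝ) / 2))) := by
  have ha' : a = d / 2 := by
    rw [ha]
    exact_mod_cast Nat.floor_div_natCast (d : ℝ) 2 |>.trans (by simp)
  have hb' : b = (d + 1) / 2 := by
    rw [hb, Nat.ceil_eq_iff (by omega)]
    have h : ((d + 1) / 2) * 2 = d ∨ ((d + 1) / 2) * 2 = d + 1 := by omega
    have h1 : 1 ≤ (d + 1) / 2 := by omega
    push_cast [h1]
    rcases h with h | h
    · have h : (((d + 1) / 2 : ℕ) : ℝ) * 2 = d := by exact_mod_cast h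
      constructor <;> linarith
    · have h : (((d + 1) / 2 : ℕ) : ℝ) * 2 = d + 1 := by exact_mod_cast h
      constructor <;> linarith
  have hsum : a + b = d := by omega
  have ha1 : 1 ≤ a := by omega
  obtain ⟨P₀, hP₀, hv₀⟩ := exists_mem_inscribedPolytopes_volume_eq ha1 (by omega : 1 ≤ b) hsum
  have hle := fun (P : Set (EuclideanSpace ℝ (Fin d))) (hP : P ∈ inscribedPolytopes d (d + 2)) =>
    volume_le_of_mem_inscribedPolytopes (by omega : a ≤ b) (by omega) hsum ha1 hP
  have hgr : IsGreatest (inscribedVolumes d (d + 2))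
      (√(simplexFactor a * simplexFactor b) / d.factorial) := by
    refine ⟨⟨P₀, hP₀, hv₀.symm⟩, ?_⟩
    rintro _ ⟨P, hP, rfl⟩
    exact (hle P hP).1
  have hmax : maxInscribedVolume d (d + 2) = √(simplexFactor a * simplexFactor b) / d.factorial :=
    hgr.csSup_eq
  refine ⟨fun P hP hPmax => ?_, hmax ▸ hgr, ?_⟩
  -- Comparison with the extremal `P₀` puts a maximiser in the equality case.
  · obtain ⟨A, p, hA, hG, rfl⟩ := (hle P hP).2
      ((hle P hP).1.antisymm (hv₀ ▸ hPmax P₀ hP₀))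
    exact exists_orthogonal_regular_simplices ha1 (by omega) hsum hA hG
  · rw [hmax, sqrt_simplexFactor_mul, one_div_mul_eq_div]
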